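/- Consider a homogeneous $3$-user $2\times1$ MISO broadcast channel with coherence time $N\ge 1$ and offsets $n_{\delta,1},n_{\delta,2},n_{\delta,3}\in\{0,\dots,N-1\}$: a transmitter with two antennas serves three single-antenna users over the time slots $n=0,1,2,\dots$; the coefficient vector $H_i(n)=(h_{i1}(n),h_{i2}(n))\in\mathbb C^2$ of user $i$ is constant on each of its fading blocks $\{0,\dots,n_{\delta,i}-1\}$ and $\{aN+n_{\delta,i},\dots,aN+n_{\delta,i}+N-1\}$, $a\ge 0$; and the vectors belonging to different users or different blocks are independent random vectors, each with an absolutely continuous law on $\mathbb C^2$. A blind linear scheme over the slots $0,\dots,T-1$ consists of numbers $d_1,d_2,d_3$ of data symbols and, for each symbol, a pair of beamforming vectors $(x_1,x_2)\in\mathbb C^T\times\mathbb C^T$ not depending on the channel values, which user $i$ receives as $H_{i1}x_1+H_{i2}x_2$ with $H_{ij}=\operatorname{diag}(h_{ij}(0),\dots,h_{ij}(T-1))$. The scheme is decodable if, almost surely, at each user $i$ the received vectors of its own $d_i$ symbols are linearly independent and their span meets the span of the received vectors of all other users' symbols only in $0$. The channel is BIA-feasible if blind linear schemes achieve the optimal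 sum DoF $\tfrac{2\cdot 3}{2+3-1}=\tfrac32$, i.e. if for every $\varepsilon>0$ and all sufficiently large $T$ there is a decodable blind linear scheme over the slots $0,\dots,T-1$ with $d_1+d_2+d_3\ge(\tfrac32-\varepsilon)T$. Four distinct slots $n_1,\dots,n_4$ form a BIA-feasible super-symbol if there are vectors $\mathbf v_k,\mathbf u_k\in\mathbb C^4$ ($k=1,2,3$), not depending on the channel values, such that, with $H_{ij}=\operatorname{diag}(h_{ij}(n_1),\dots,h_{ij}(n_4))$, almost surely for every user $i$: $\operatorname{span}\{H_{i1}\mathbf v_k:k\ne i\}=\operatorname{span}\{H_{i2}\mathbf u_k:k\ne i\}$, the vectors $H_{i1}\mathbf v_i$ and $H_{i2}\mathbf u_i$ are linearly independent, and their span meets the span of all $H_{i1}\mathbf v_k,H_{i2}\mathbf u_k$ with $k\neq i$ only in $0$. If any two of $n_{\delta,1},n_{\delta,2},n_{\delta,3}$ are equal, then the channel is not BIA-feasible; moreover, it cannot be decomposed into BIA-feasible super-symbols, i.e. no sequence of pairwise disjoint BIA-feasible super-symbols covers all but finitely many time slots. -/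

import Mathlib

open MeasureTheory ProbabilityTheory Filter

/-- The index of the fading block that contains time slot `n`, for coherence time `N` and initial
offset `δ < N`: the slots `0, …, δ - 1` form block `0` (empty if `δ = 0`), and the slots
`a * N + δ, …, a * N + δ + N - 1` form block `a + 1`. -/
def blockIndex (N δ n : ℕ) : ℕ := if n < δ then 0 else (n - δ) / N + 1

/-- A homogeneous `K`-user `2 × 1` MISO broadcast channel: all users have the same coherence time
`N`, user `i` has the initial offset `offset i ∈ {0, …, N - 1}`, and the links to the users undergo
independent block fading. `state i a` is the random coefficient vector `(h_{i1}, h_{i2})` of user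
`i` during its `a`-th fading block. The vectors of different users or different blocks are
independent, and each has a continuous distribution (a density on `ℂ²`). -/
structure HomogeneousBC (K : ℕ) {Ω : Type*} [MeasurableSpace Ω] (P : Measure Ω) where
  N : ℕ
  N_pos : 0 < N
  offset : Fin K → ℕ
  offset_lt : ∀ i, offset i < N
  state : Fin K → ℕ → Ω → (Fin 2 → ℂ)
  measurable_state : ∀ i a, Measurable (state i a)
  indep_state : iIndepFun (fun p : Fin K × ℕ => state p.1 p.2) P
  continuous_law : ∀ i a, P.map (state i a) ≪ volume

/-- A receiver separates the desired vectors from the interfering ones: the desired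
vectors are linearly independent and their span meets the span of the interference only in `0`
(so that every desired symbol can be detected with no interference). -/
def Separates {ι V : Type*} [AddCommGroup V] [Module ℂ V] (desired : ι → V) (interference : Set V) :
    Prop :=
  LinearIndependent ℂ desired ∧
    Disjoint (Submodule.span ℂ (Set.range desired)) (Submodule.span ℂ interference)

/-- A linear transmission scheme over `T` slots that does not depend on the channel values:
user `k` is sent `streams k` data symbols, and the `s`-th one is modulated onto the vector
`beam k s j ∈ ℂ^T` at transmit antenna `j`. -/
structure BlindScheme (K T : ℕ) where
  streams : Fin K → ℕ
  beam : (k : Fin K) → Fin (streams k) → Fin 2 → Fin T → ℂ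

namespace HomogeneousBC

variable {K : ℕ} {Ω : Type*} [MeasurableSpace Ω] {P : Measure Ω}

/-- The channel coefficient `h_{ij}(n)` from transmit antenna `j` to user `i` at time `n`. -/
def coeff (bc : HomogeneousBC K P) (i : Fin K) (j : Fin 2) (n : ℕ) (ω : Ω) : ℂ :=
  bc.state i (blockIndex bc.N (bc.offset i) n) ω j

/-- `H_{ij} w`, where `H_{ij} = diag(h_{ij}(n_1), …, h_{ij}(n_T))`, for the time slots
`n_1, …, n_T` listed by `slots`. -/
def antennaRx (bc : HomogeneousBC K P) {T : ℕ} (slots : Fin T → ℕ) (ω : Ω) (i : Fin K) (j : Fin 2)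
    (w : Fin T → ℂ) : Fin T → ℂ :=
  fun t => bc.coeff i j (slots t) ω * w t

/-- The noiseless signal `H_{i1} x_1 + H_{i2} x_2` of user `i` when antenna `j` sends `x_j`. -/
def rx (bc : HomogeneousBC K P) {T : ℕ} (slots : Fin T → ℕ) (ω : Ω) (i : Fin K)
    (x : Fin 2 → Fin T → ℂ) : Fin T → ℂ :=
  ∑ j, bc.antennaRx slots ω i j (x j)

/-- Over the slots `0, …, T - 1`, with probability one, every user separates
its own data symbols from the interference caused by the symbols of all other users. -/
def Decodable (bc : HomogeneousBC K P) {T : ℕ} (c : BlindScheme K T) : Prop :=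
  ∀ᵐ ω ∂P, ∀ i : Fin K,
    Separates (fun s : Fin (c.streams i) => bc.rx Fin.val ω i (c.beam i s))
      {y | ∃ k, k ≠ i ∧ ∃ s, y = bc.rx Fin.val ω i (c.beam k s)}

/-- The sum DoF `d` is achieved, over the infinite sequence of time slots, by linear transmission
without channel state information at the transmitter: for every `ε > 0` and every large horizon
`T`, at least `(d - ε) T` interference-free symbols can be delivered in `T` channel uses. -/
def AchievesBlindly (bc : HomogeneousBC K P) (d : ℝ) : Prop :=
  ∀ ε : ℝ, 0 < ε → ∀ᶠ T : ℕ in atTop, ∃ c : BlindScheme K T,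
    bc.Decodable c ∧ (d - ε) * T ≤ ∑ k, (c.streams k : ℝ)

/-- The channel is BIA-feasible: the optimal sum DoF `2K / (2 + K - 1)` is achieved blindly. -/
def IsBIAFeasible (bc : HomogeneousBC K P) : Prop :=
  bc.AchievesBlindly (2 * (K : ℝ) / (2 + K - 1))

/-- The `K + 1` time slots listed by `slots` form a BIA-feasible super-symbol: signalling vectors
`v 0 k` (at the first antenna) and `v 1 k` (at the second antenna), for the two symbols of user
`k`, can be chosen independently of the channel values such that, with probability one, at every
user `i` the interference arriving from the two antennas is aligned, and the two desired vectors
are separated from the interference. -/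
def IsBIABlock (bc : HomogeneousBC K P) (slots : Fin (K + 1) → ℕ) : Prop :=
  ∃ v : Fin 2 → Fin K → Fin (K + 1) → ℂ, ∀ᵐ ω ∂P, ∀ i : Fin K,
    Submodule.span ℂ {y | ∃ k, k ≠ i ∧ y = bc.antennaRx slots ω i 0 (v 0 k)} =
      Submodule.span ℂ {y | ∃ k, k ≠ i ∧ y = bc.antennaRx slots ω i 1 (v 1 k)} ∧
    Separates (fun j : Fin 2 => bc.antennaRx slots ω i j (v j i))
      {y | ∃ k, k ≠ i ∧ ∃ j, y = bc.antennaRx slots ω i j (v j k)}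

/-- All time slots, except possibly some in an initial segment, are decomposed into pairwise
disjoint BIA-feasible super-symbols of `K + 1` distinct slots each. -/
def IsBIADecomposable (bc : HomogeneousBC K P) : Prop :=
  ∃ (n₀ : ℕ) (b : ℕ → Fin (K + 1) → ℕ),
    (∀ m, bc.IsBIABlock (b m)) ∧
    Function.Injective (fun p : ℕ × Fin (K + 1) => b p.1 p.2) ∧
    ∀ n, n₀ ≤ n → ∃ m t, b m t = n

end HomogeneousBC

/-! Two users i, j with equal offsets have the same fading blocks, so a beamforming subspace A
almost surely has the same received dimension r(A), the maximal one, at both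
(`exists_ae_finrank_map_eq`). Let X_i, X_j, X_k be the beam spans and R = r(X_i + X_j + X_k).
Decodability at i and j gives R = d_i + r(X_j + X_k) = d_j + r(X_i + X_k), and submodularity of r
turns this into d_i + d_j + r(X_k) ≤ R ≤ T. With only two antennas, a generic receiver retains at
least half of any dimension (`ae_finrank_le_two_mul`). Hence r(X_k) ≥ d_k/2, so d_i + d_j + d_k/2 ≤
T. Also dim(X_i + X_j) ≥ R - r(X_k) ≥ d_i + d_j, so user k sees interference of dimension at least
(d_i + d_j)/2, and d_k + (d_i + d_j)/2 ≤ T. Adding, the sum rate is at most 4/3 < 3/2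
(`three_mul_streams_le`). -/

/-! ### Zero sets of entire functions -/

/-- A measure for which every entire function with a nonzero value is nonzero almost everywhere. -/
def NullZeros {E : Type*} [NormedAddCommGroup E] [NormedSpace ℂ E] [MeasurableSpace E]
    (μ : Measure E) : Prop :=
  ∀ f : E → ℂ, Differentiable ℂ f → (∃ x, f x ≠ 0) → ∀ᵐ x ∂μ, f x ≠ 0

theorem NullZeros.of_absolutelyContinuous {E : Type*} [NormedAddCommGroup E] [NormedSpace ℂ E]
    [MeasurableSpace E] {μ ν : Measure E} (hν : NullZeros ν) (h : μ ≪ ν) : NullZeros μ :=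
  fun f hf hx => h.ae_le (hν f hf hx)

theorem nullZeros_volume_complex : NullZeros (volume : Measure ℂ) := by
  rintro f hf ⟨x, hx⟩
  have ha : AnalyticOnNhd ℂ f Set.univ := fun z _ => hf.analyticAt z
  have h := ae_restrict_le_codiscreteWithin (μ := volume) MeasurableSet.univ
    (ha.preimage_zero_mem_codiscrete hx)
  rw [Measure.restrict_univ] at h
  filter_upwards [h] with z hz using hz

/-- Fubini: freezing one coordinate at a point where f is nonzero handles almost every slice, and
each such slice is again a nonzero entire function. -/
theorem NullZeros.prod {E F : Type*} [NormedAddCommGroup E] [NormedSpace ℂ E] [MeasurableSpace E]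
    [BorelSpace E] [SecondCountableTopology E] [NormedAddCommGroup F] [NormedSpace ℂ F]
    [MeasurableSpace F] [BorelSpace F] {μ : Measure E} {ν : Measure F} [SFinite ν]
    (hμ : NullZeros μ) (hν : NullZeros ν) : NullZeros (μ.prod ν) := by
  rintro f hf ⟨⟨x, y⟩, hxy⟩
  have hm : MeasurableSet {p | f p ≠ 0} :=
    (isOpen_ne_fun hf.continuous continuous_const).measurableSet
  rw [Measure.ae_prod_iff_ae_ae hm]
  filter_upwards [hμ (fun z => f (z, y)) (by fun_prop) ⟨x, hxy⟩] with z hz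
  exact hν (fun w => f (z, w)) (by fun_prop) ⟨y, hz⟩

theorem NullZeros.of_measurePreserving {E F : Type*} [NormedAddCommGroup E] [NormedSpace ℂ E]
    [MeasurableSpace E] [NormedAddCommGroup F] [NormedSpace ℂ F] [MeasurableSpace F]
    {μ : Measure E} {ν : Measure F} (hν : NullZeros ν) {e : E → F} (he : MeasurePreserving e μ ν)
    (e' : F → E) (hd : Differentiable ℂ e') (hl : ∀ x, e' (e x) = x) : NullZeros μ := by
  rintro f hf ⟨x, hx⟩
  have h := he.quasiMeasurePreserving.ae (hν (fun y => f (e' y)) (hf.comp hd) ⟨e x, by rwa [hl]⟩)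
  simpa only [hl] using h

theorem nullZeros_volume_pair : NullZeros (volume : Measure (Fin 2 → ℂ)) := by
  refine (nullZeros_volume_complex.prod nullZeros_volume_complex).of_measurePreserving
    (volume_preserving_finTwoArrow ℂ) (fun p => ![p.1, p.2]) ?_ ?_
  · rw [differentiable_pi]
    intro i
    fin_cases i
    · exact differentiable_fst
    · exact differentiable_snd
  · intro x
    ext i
    fin_cases i <;> rfl

theorem nullZeros_pi {E : Type*} [NormedAddCommGroup E] [NormedSpace ℂ E] [MeasurableSpace E]
    [BorelSpace E] [SecondCountableTopology E] {n : ℕ} (μ : Fin n → Measure E)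
    [∀ a, SigmaFinite (μ a)] (hμ : ∀ a, NullZeros (μ a)) : NullZeros (Measure.pi μ) := by
  induction n with
  | zero =>
    rintro f - ⟨x, hx⟩
    exact Eventually.of_forall fun y => by rwa [Subsingleton.elim y x]
  | succ n ih =>
    refine ((hμ 0).prod (ih (fun a => μ ((0 : Fin (n + 1)).succAbove a))
      fun a => hμ _)).of_measurePreserving (measurePreserving_piFinSuccAbove μ 0) (fun p => Fin.cons p.1 p.2) ?_ ?_
    · rw [differentiable_pi]
      intro i
      refine Fin.cases ?_ (fun i => ?_) i
      · exact differentiable_fst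
      · simp only [Fin.cons_succ]
        fun_prop
    · intro x
      exact Fin.cons_self_tail x

/-! ### Generic rank of the received signal -/

/-- The linear map taking a pair of beamforming vectors to the signal received when slot `t` lies
in fading block `bl t` and `h` lists the coefficient vectors of the blocks. -/
def blockRx {T : ℕ} {β : Type*} (bl : Fin T → β) (h : β → Fin 2 → ℂ) :
    (Fin 2 → Fin T → ℂ) →ₗ[ℂ] (Fin T → ℂ) where
  toFun x t := ∑ j, h (bl t) j * x j t
  map_add' x y := by
    ext t
    simp [mul_add, Finset.sum_add_distrib]
  map_smul' c x := by
    ext t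
    simp only [Pi.smul_apply, smul_eq_mul, RingHom.id_apply, Finset.mul_sum]
    exact Finset.sum_congr rfl fun j _ => by ring

theorem differentiable_blockRx {T n : ℕ} (bl : Fin T → Fin n) (x : Fin 2 → Fin T → ℂ) :
    Differentiable ℂ fun h : Fin n → Fin 2 → ℂ => blockRx bl h x := by
  simp only [blockRx, LinearMap.coe_mk, AddHom.coe_mk]
  fun_prop

theorem Differentiable.matrix_det {E κ : Type*} [NormedAddCommGroup E] [NormedSpace ℂ E] [Fintype κ]
    [DecidableEq κ] {M : E → Matrix κ κ ℂ} (hM : ∀ s t, Differentiable ℂ fun h => M h s t) :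
    Differentiable ℂ fun h => (M h).det := by
  simp only [Matrix.det_apply]
  fun_prop

/-- A left inverse at `h₀` yields a square minor that is entire in `h` and equals 1 at `h₀`;
wherever it is nonzero, independence persists. -/
theorem NullZeros.ae_linearIndependent {E V κ : Type*} [NormedAddCommGroup E] [NormedSpace ℂ E]
    [MeasurableSpace E] [NormedAddCommGroup V] [NormedSpace ℂ V] [FiniteDimensional ℂ V] [Fintype κ]
    {μ : Measure E} (hμ : NullZeros μ) {y : κ → E → V} (hy : ∀ s, Differentiable ℂ (y s)) {h₀ : E}
    (h : LinearIndependent ℂ fun s => y s h₀) :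
    ∀ᵐ h ∂μ, LinearIndependent ℂ fun s => y s h := by
  classical
  obtain ⟨g, hg⟩ := (Fintype.linearCombination ℂ fun s => y s h₀).exists_leftInverse_of_injective
    (LinearMap.ker_eq_bot.2 (linearIndependent_iff_injective_fintypeLinearCombination.1 h))
  let M : E → Matrix κ κ ℂ := fun h => Matrix.of fun s => g (y s h)
  have hM₀ : M h₀ = 1 := by
    ext s t
    have := congrFun (LinearMap.congr_fun hg (Pi.single s 1)) t
    simp only [LinearMap.comp_apply, Fintype.linearCombination_apply_single, one_smul,
      LinearMap.id_apply] at this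
    simp [M, this, Matrix.one_apply, Pi.single_apply, eq_comm]
  have hd : Differentiable ℂ fun h => (M h).det := by
    refine Differentiable.matrix_det fun s t => ?_
    have := (LinearMap.toContinuousLinearMap g).differentiable.comp (hy s)
    exact differentiable_pi.1 this t
  filter_upwards [hμ _ hd ⟨h₀, by simp [hM₀]⟩] with h hh
  have hr := Matrix.linearIndependent_rows_iff_isUnit.2
    ((Matrix.isUnit_iff_isUnit_det _).2 (isUnit_iff_ne_zero.2 hh))
  exact LinearIndependent.of_comp g hr

theorem NullZeros.ae_finrank_map_le {T n : ℕ} {μ : Measure (Fin n → Fin 2 → ℂ)} (hμ : NullZeros μ)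
    (bl : Fin T → Fin n) (A : Submodule ℂ (Fin 2 → Fin T → ℂ)) (h₀ : Fin n → Fin 2 → ℂ) :
    ∀ᵐ h ∂μ, Module.finrank ℂ (A.map (blockRx bl h₀)) ≤ Module.finrank ℂ (A.map (blockRx bl h)) := by
  have b := Module.finBasis ℂ (A.map (blockRx bl h₀))
  have hbA (s) : ∃ x ∈ A, blockRx bl h₀ x = b s := Submodule.mem_map.1 (b s).2
  choose x hxA hx using hbA
  have hb : LinearIndependent ℂ fun s => blockRx bl h₀ (x s) := by
    simp only [hx]
    exact b.linearIndependent.map' (A.map (blockRx bl h₀)).subtype (Submodule.ker_subtype _)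
  filter_upwards [hμ.ae_linearIndependent (y := fun s h => blockRx bl h (x s)) (h₀ := h₀)
    (fun s => differentiable_blockRx bl (x s)) hb] with h hh
  have hc := finrank_span_eq_card hh
  rw [Fintype.card_fin] at hc
  rw [← hc]
  refine Submodule.finrank_mono (Submodule.span_le.2 ?_)
  rintro _ ⟨s, rfl⟩
  exact Submodule.mem_map_of_mem (hxA s)

/-- The span of the beamforming vector pairs of user `k`. -/
def BlindScheme.beamSpan {K T : ℕ} (c : BlindScheme K T) (k : Fin K) :
    Submodule ℂ (Fin 2 → Fin T → ℂ) :=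
  Submodule.span ℂ (Set.range (c.beam k))

namespace HomogeneousBC

variable {K : ℕ} {Ω : Type*} [MeasurableSpace Ω] {P : Measure Ω}

/-- The fading blocks of user `i` that contain the given slots. -/
def blocks (bc : HomogeneousBC K P) {T : ℕ} (slots : Fin T → ℕ) (i : Fin K) (t : Fin T) : ℕ :=
  blockIndex bc.N (bc.offset i) (slots t)

theorem rx_eq_blockRx (bc : HomogeneousBC K P) {T : ℕ} (slots : Fin T → ℕ) (ω : Ω) (i : Fin K)
    (x : Fin 2 → Fin T → ℂ) :
    bc.rx slots ω i x = blockRx (bc.blocks slots i) (fun a => bc.state i a ω) x := by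
  ext t
  simp [rx, antennaRx, coeff, blockRx, blocks]

theorem ae_finrank_map_le [IsProbabilityMeasure P] (bc : HomogeneousBC K P) {T : ℕ}
    (bl : Fin T → ℕ) (i : Fin K) (A : Submodule ℂ (Fin 2 → Fin T → ℂ)) (h₀ : ℕ → Fin 2 → ℂ) :
    ∀ᵐ ω ∂P, Module.finrank ℂ (A.map (blockRx bl h₀)) ≤
      Module.finrank ℂ (A.map (blockRx bl fun a => bc.state i a ω)) := by
  -- Only finitely many blocks meet the slots, so the relevant states have a finite product law.
  let n := Finset.univ.sup bl + 1
  let bl' : Fin T → Fin n := fun t => ⟨bl t, Nat.lt_succ_of_le (Finset.le_sup (Finset.mem_univ t))⟩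
  have hind : iIndepFun (fun a : Fin n => bc.state i a) P :=
    bc.indep_state.precomp (g := fun a : Fin n => (i, (a : ℕ))) fun a b hab => by
      simpa [Fin.ext_iff] using hab
  have hlaw := (iIndepFun_iff_map_fun_eq_pi_map fun a : Fin n =>
    (bc.measurable_state i a).aemeasurable).1 hind
  have (a : Fin n) : IsProbabilityMeasure (P.map (bc.state i a)) :=
    Measure.isProbabilityMeasure_map (bc.measurable_state i a).aemeasurable
  have h := (nullZeros_pi (fun a : Fin n => P.map (bc.state i a)) fun a =>
    nullZeros_volume_pair.of_absolutelyContinuous (bc.continuous_law i a)).ae_finrank_map_le bl' A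
      fun a => h₀ a
  rw [← hlaw] at h
  have hm : Measurable fun ω (a : Fin n) => bc.state i a ω :=
    measurable_pi_lambda _ fun a => bc.measurable_state i a
  exact ae_of_ae_map hm.aemeasurable h

/-- The common value is the maximum over all deterministic states; it depends only on the block
pattern, not on the user. -/
theorem exists_ae_finrank_map_eq [IsProbabilityMeasure P] (bc : HomogeneousBC K P) {T : ℕ}
    (bl : Fin T → ℕ) (A : Submodule ℂ (Fin 2 → Fin T → ℂ)) :
    ∃ r, ∀ i, ∀ᵐ ω ∂P, Module.finrank ℂ (A.map (blockRx bl fun a => bc.state i a ω)) = r := by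
  let ρ : (ℕ → Fin 2 → ℂ) → ℕ := fun h => Module.finrank ℂ (A.map (blockRx bl h))
  have hbdd : BddAbove (Set.range ρ) := ⟨T, by
    rintro _ ⟨h, rfl⟩
    simpa using Submodule.finrank_le (A.map (blockRx bl h))⟩
  obtain ⟨h₀, hh₀⟩ := Nat.sSup_mem (Set.range_nonempty ρ) hbdd
  refine ⟨ρ h₀, fun i => ?_⟩
  filter_upwards [bc.ae_finrank_map_le bl i A h₀] with ω hω
  exact le_antisymm (hh₀ ▸ le_csSup hbdd ⟨_, rfl⟩) hω

/-- The constant states `Pi.single 0 1` and `Pi.single 1 1` isolate the two antennas. Their images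
of `A` jointly determine it, and neither exceeds the generic rank. -/
theorem ae_finrank_le_two_mul [IsProbabilityMeasure P] (bc : HomogeneousBC K P) {T : ℕ}
    (bl : Fin T → ℕ) (i : Fin K) (A : Submodule ℂ (Fin 2 → Fin T → ℂ)) :
    ∀ᵐ ω ∂P, Module.finrank ℂ A ≤
      2 * Module.finrank ℂ (A.map (blockRx bl fun a => bc.state i a ω)) := by
  filter_upwards [bc.ae_finrank_map_le bl i A fun _ => Pi.single 0 1,
    bc.ae_finrank_map_le bl i A fun _ => Pi.single 1 1] with ω h₀ h₁
  let p : Fin 2 → (Fin 2 → Fin T → ℂ) →ₗ[ℂ] (Fin T → ℂ) := fun j => blockRx bl fun _ => Pi.single j 1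
  have hp (j : Fin 2) (x : Fin 2 → Fin T → ℂ) : p j x = x j := by
    ext t
    simp [p, blockRx, Pi.single_apply]
  let q := ((p 0).submoduleMap A).prod ((p 1).submoduleMap A)
  have hq : Function.Injective q := by
    intro x y hxy
    have h0 := congrArg (fun z => (z.1 : Fin T → ℂ)) hxy
    have h1 := congrArg (fun z => (z.2 : Fin T → ℂ)) hxy
    simp only [q, LinearMap.prod_apply, Function.prod_apply, LinearMap.submoduleMap_coe_apply,
      hp] at h0 h1
    ext j : 2
    fin_cases j
    · exact h0
    · exact h1
  have h := LinearMap.finrank_le_finrank_of_injective hq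
  rw [Module.finrank_prod] at h
  change _ ≤ Module.finrank ℂ (A.map (p 0)) + Module.finrank ℂ (A.map (p 1)) at h
  change Module.finrank ℂ (A.map (p 0)) ≤ _ at h₀
  change Module.finrank ℂ (A.map (p 1)) ≤ _ at h₁
  omega

/-! ### Dimension counts under decodability -/

theorem finrank_map_sup_of_separates (bc : HomogeneousBC K P) {T : ℕ} (slots : Fin T → ℕ)
    (c : BlindScheme K T) (ω : Ω) {i : Fin K}
    (hsep : Separates (fun s : Fin (c.streams i) => bc.rx slots ω i (c.beam i s))
      {y | ∃ k, k ≠ i ∧ ∃ s, y = bc.rx slots ω i (c.beam k s)})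
    {B : Submodule ℂ (Fin 2 → Fin T → ℂ)} (hB : B ≤ ⨆ k, ⨆ (_ : k ≠ i), c.beamSpan k) :
    Module.finrank ℂ ((c.beamSpan i ⊔ B).map
      (blockRx (bc.blocks slots i) fun a => bc.state i a ω)) = c.streams i +
      Module.finrank ℂ (B.map (blockRx (bc.blocks slots i) fun a => bc.state i a ω)) := by
  simp only [rx_eq_blockRx] at hsep
  set L := blockRx (bc.blocks slots i) fun a => bc.state i a ω
  obtain ⟨hli, hdis⟩ := hsep
  have hi : (c.beamSpan i).map L = Submodule.span ℂ (Set.range fun s => L (c.beam i s)) := by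
    rw [BlindScheme.beamSpan, Submodule.map_span, ← Set.range_comp]
    rfl
  have hBL : B.map L ≤ Submodule.span ℂ {y | ∃ k, k ≠ i ∧ ∃ s, y = L (c.beam k s)} := by
    refine (Submodule.map_mono hB).trans ?_
    rw [Submodule.map_le_iff_le_comap]
    refine iSup₂_le fun k hk => Submodule.span_le.2 ?_
    rintro _ ⟨s, rfl⟩
    exact Submodule.subset_span ⟨k, hk, s, rfl⟩
  have hd := hdis.mono_right hBL
  rw [← hi] at hd
  have hs := Submodule.finrank_sup_add_finrank_inf_eq ((c.beamSpan i).map L) (B.map L)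
  have hc := finrank_span_eq_card hli
  rw [← hi, Fintype.card_fin] at hc
  rw [hd.eq_bot, finrank_bot, hc, ← Submodule.map_sup] at hs
  exact hs

theorem three_mul_streams_le [IsProbabilityMeasure P] (bc : HomogeneousBC K P) {i j k : Fin K}
    (hij : i ≠ j) (hik : i ≠ k) (hjk : j ≠ k) (hoff : bc.offset i = bc.offset j) {T : ℕ}
    (slots : Fin T → ℕ) (c : BlindScheme K T)
    (hc : ∀ᵐ ω ∂P, ∀ i, Separates (fun s : Fin (c.streams i) => bc.rx slots ω i (c.beam i s))
      {y | ∃ k, k ≠ i ∧ ∃ s, y = bc.rx slots ω i (c.beam k s)}) :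
    3 * (c.streams i + c.streams j + c.streams k) ≤ 4 * T := by
  have hbl : bc.blocks slots j = bc.blocks slots i := by
    ext t
    simp [blocks, hoff]
  set X := c.beamSpan with hX
  have hle {l m : Fin K} (h : m ≠ l) : X m ≤ ⨆ k, ⨆ (_ : k ≠ l), X k :=
    le_iSup₂_of_le m h le_rfl
  have hgen (A : Submodule ℂ (Fin 2 → Fin T → ℂ)) : ∀ᵐ ω ∂P,
      Module.finrank ℂ (A.map (blockRx (bc.blocks slots i) fun a => bc.state j a ω)) =
        Module.finrank ℂ (A.map (blockRx (bc.blocks slots i) fun a => bc.state i a ω)) := by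
    obtain ⟨r, hr⟩ := bc.exists_ae_finrank_map_eq (bc.blocks slots i) A
    filter_upwards [hr i, hr j] with ω hi hj
    rw [hi, hj]
  -- All almost sure statements hold together at one outcome; the rest is linear algebra there.
  obtain ⟨ω, hsep, h₁, h₂, h₃, h₄⟩ := (hc.and <| (hgen (X j ⊔ (X i ⊔ X k))).and <|
    (hgen (X i ⊔ X k)).and <| (bc.ae_finrank_le_two_mul (bc.blocks slots i) i (X k)).and
      (bc.ae_finrank_le_two_mul (bc.blocks slots k) k (X i ⊔ X j))).exists
  have hi := bc.finrank_map_sup_of_separates slots c ω (hsep i)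
    (sup_le (hle hij.symm) (hle hik.symm) : X j ⊔ X k ≤ _)
  have hj := bc.finrank_map_sup_of_separates slots c ω (hsep j)
    (sup_le (hle hij) (hle hjk.symm) : X i ⊔ X k ≤ _)
  have hk := bc.finrank_map_sup_of_separates slots c ω (hsep k)
    (sup_le (hle hik) (hle hjk) : X i ⊔ X j ≤ _)
  have hk₀ := bc.finrank_map_sup_of_separates slots c ω (hsep k) bot_le
  rw [← hX] at hi hj hk hk₀
  rw [hbl, h₁, h₂] at hj
  have hT (V : Submodule ℂ (Fin T → ℂ)) : Module.finrank ℂ V ≤ T := by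
    simpa using Submodule.finrank_le V
  set L := blockRx (bc.blocks slots i) fun a => bc.state i a ω
  set L' := blockRx (bc.blocks slots k) fun a => bc.state k a ω
  have hkT := hT ((X k ⊔ (X i ⊔ X j)).map L')
  have hdk : c.streams k ≤ Module.finrank ℂ (X k) := by
    rw [sup_bot_eq, Submodule.map_bot, finrank_bot, add_zero] at hk₀
    exact hk₀.symm.le.trans (Submodule.finrank_map_le L' (X k))
  -- Submodularity: both images contain that of `X k`.
  have hsub := Submodule.finrank_sup_add_finrank_inf_eq ((X j ⊔ X k).map L) ((X i ⊔ X k).map L)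
  have hinf : Module.finrank ℂ ((X k).map L) ≤
      Module.finrank ℂ ↥((X j ⊔ X k).map L ⊓ (X i ⊔ X k).map L) :=
    Submodule.finrank_mono (le_inf (Submodule.map_mono le_sup_right)
      (Submodule.map_mono le_sup_right))
  have hall : X j ⊔ X k ⊔ (X i ⊔ X k) = X i ⊔ (X j ⊔ X k) := by
    rw [sup_sup_sup_comm, sup_idem, sup_comm (X j), sup_assoc]
  have hall' : X j ⊔ (X i ⊔ X k) = X i ⊔ (X j ⊔ X k) := sup_left_comm _ _ _
  rw [← Submodule.map_sup, hall] at hsub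
  rw [hall'] at hj
  have hiT := hT ((X i ⊔ (X j ⊔ X k)).map L)
  have hij' := Submodule.finrank_add_le_finrank_add_finrank ((X i ⊔ X j).map L) ((X k).map L)
  rw [← Submodule.map_sup, sup_assoc] at hij'
  have hdim := Submodule.finrank_map_le L (X i ⊔ X j)
  omega

theorem three_mul_sum_streams_le [IsProbabilityMeasure P] (bc : HomogeneousBC 3 P)
    (hoff : ∃ i j : Fin 3, i ≠ j ∧ bc.offset i = bc.offset j) {T : ℕ} (slots : Fin T → ℕ)
    (c : BlindScheme 3 T)
    (hc : ∀ᵐ ω ∂P, ∀ i, Separates (fun s : Fin (c.streams i) => bc.rx slots ω i (c.beam i s))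
      {y | ∃ k, k ≠ i ∧ ∃ s, y = bc.rx slots ω i (c.beam k s)}) :
    3 * ∑ k, c.streams k ≤ 4 * T := by
  obtain ⟨i, j, hij, h⟩ := hoff
  have key : ∀ i j : Fin 3, i ≠ j → ∃ k, i ≠ k ∧ j ≠ k ∧ Finset.univ = {i, j, k} := by decide
  obtain ⟨k, hik, hjk, huniv⟩ := key i j hij
  have hsum : ∑ k, c.streams k = c.streams i + c.streams j + c.streams k := by
    rw [huniv, Finset.sum_insert (by simp [hij, hik]), Finset.sum_pair hjk, add_assoc]
  rw [hsum]
  exact bc.three_mul_streams_le hij hik hjk h slots c hc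

theorem not_isBIABlock [IsProbabilityMeasure P] (bc : HomogeneousBC 3 P)
    (hoff : ∃ i j : Fin 3, i ≠ j ∧ bc.offset i = bc.offset j) (slots : Fin (3 + 1) → ℕ) :
    ¬ bc.IsBIABlock slots := by
  rintro ⟨v, hv⟩
  let c : BlindScheme 3 (3 + 1) :=
    { streams := fun _ => 2
      beam := fun k s => Pi.single s (v s k) }
  have hrx (ω : Ω) (i k : Fin 3) (s : Fin 2) :
      bc.rx slots ω i (Pi.single s (v s k)) = bc.antennaRx slots ω i s (v s k) := by
    ext t
    fin_cases s <;> simp [rx, antennaRx]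
  have h := bc.three_mul_sum_streams_le hoff slots c <| by
    filter_upwards [hv] with ω hω i
    simpa only [c, hrx] using (hω i).2
  -- Six symbols in four slots would give 18 ≤ 16.
  simp [c] at h

end HomogeneousBC

theorem mainTheorem9 {Ω : Type*} [MeasurableSpace Ω] (P : Measure Ω) [IsProbabilityMeasure P]
    (bc : HomogeneousBC 3 P)
    (hoff : ∃ i j : Fin 3, i ≠ j ∧ bc.offset i = bc.offset j) :
    ¬ bc.IsBIAFeasible ∧ ¬ bc.IsBIADecomposable := by
  refine ⟨fun h => ?_, fun ⟨_, b, hb, _⟩ => bc.not_isBIABlock hoff (b 0) (hb 0)⟩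
  -- Any ε below 3/2 - 4/3 = 1/6 would do.
  obtain ⟨T, ⟨c, hc, hle⟩, hT⟩ :=
    ((h (1 / 12) (by norm_num)).and (eventually_gt_atTop 0)).exists
  have hs : (3 : ℝ) * ∑ k, (c.streams k : ℝ) ≤ 4 * T :=
    mod_cast bc.three_mul_sum_streams_le hoff Fin.val c hc
  have hT' : (0 : ℝ) < T := mod_cast hT
  norm_num at hle
  linarith
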